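/- For every integer $k>0$, the complex projective space $\mathbb{C}P^{2k-1}$ is the boundary of a compact oriented manifold: there are a compact oriented smooth $(4k-1)$-dimensional manifold with boundary $W$ (Hausdorff and second countable) and a smooth embedding $\iota:\mathbb{C}P^{2k-1}\to W$ with image exactly $\partial W$, such that $\iota$, as a diffeomorphism $\mathbb{C}P^{2k-1}\cong\partial W$, preserves orientations. Here $\mathbb{C}P^{2k-1}$ carries the orientation given by its complex structure and $\partial W$ carries the boundary orientation induced from $W$ (outward vector first). -/

import Mathlib

open Set Filter Topology Module
open scoped Manifold ContDiff LinearAlgebra.Projectivization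

/-- Complex projective space of complex dimension `m`: the lines through the origin of
`ℂ ^ (m + 1)`. -/
def ComplexProjectiveSpace (m : ℕ) : Type :=
  ℙ ℂ (Fin (m + 1) → ℂ)

namespace ComplexProjectiveSpace

variable {m : ℕ}

/-- The point with homogeneous coordinates `z`. -/
noncomputable def mk (z : Fin (m + 1) → ℂ) (hz : z ≠ 0) : ComplexProjectiveSpace m :=
  Projectivization.mk ℂ z hz

/-- The quotient topology from `ℂ ^ (m + 1)` without the origin. -/
noncomputable instance : TopologicalSpace (ComplexProjectiveSpace m) :=
  TopologicalSpace.coinduced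
    (fun z : {z : Fin (m + 1) → ℂ // z ≠ 0} => mk z.1 z.2) inferInstance

theorem isQuotientMap_mk :
    IsQuotientMap (fun z : {z : Fin (m + 1) → ℂ // z ≠ 0} => mk z.1 z.2) := by
  refine ⟨⟨rfl⟩, fun p => ?_⟩
  induction p using Projectivization.ind with
  | h z hz => exact ⟨⟨z, hz⟩, rfl⟩

theorem mk_eq_mk_iff {z w : Fin (m + 1) → ℂ} (hz : z ≠ 0) (hw : w ≠ 0) :
    mk z hz = mk w hw ↔ ∃ a : ℂ, a • w = z :=
  Projectivization.mk_eq_mk_iff' ℂ z w hz hw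

/-- The affine coordinates `z_j / z_i`, `j ≠ i`, of a point (meaningful where `z_i ≠ 0`). -/
noncomputable def affineCoord (i : Fin (m + 1)) (p : ComplexProjectiveSpace m) : Fin m → ℂ :=
  Projectivization.lift
    (fun (z : {z : Fin (m + 1) → ℂ // z ≠ 0}) (j : Fin m) => z.1 (i.succAbove j) / z.1 i) (by
      rintro ⟨a, ha⟩ ⟨b, hb⟩ t h
      have h' : a = t • b := h
      have ht : t ≠ 0 := by
        rintro rfl
        exact ha (by simpa using h')
      subst h'
      ext j
      exact mul_div_mul_left _ _ ht) p

@[simp]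
theorem affineCoord_mk (i : Fin (m + 1)) (z : Fin (m + 1) → ℂ) (hz : z ≠ 0) (j : Fin m) :
    affineCoord i (mk z hz) j = z (i.succAbove j) / z i :=
  rfl

theorem insertNth_one_ne_zero (i : Fin (m + 1)) (w : Fin m → ℂ) :
    i.insertNth (α := fun _ => ℂ) 1 w ≠ 0 := by
  intro h
  have := congrFun h i
  simp at this

/-- The locus `z_i ≠ 0`. -/
def affineDomain (i : Fin (m + 1)) : Set (ComplexProjectiveSpace m) :=
  {p | ∃ (z : Fin (m + 1) → ℂ) (hz : z ≠ 0), z i ≠ 0 ∧ mk z hz = p}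

@[simp]
theorem mk_mem_affineDomain {i : Fin (m + 1)} {z : Fin (m + 1) → ℂ} {hz : z ≠ 0} :
    mk z hz ∈ affineDomain i ↔ z i ≠ 0 := by
  constructor
  · rintro ⟨w, hw, hwi, h⟩
    obtain ⟨a, rfl⟩ := (mk_eq_mk_iff hw hz).1 h
    exact fun h0 => hwi (by simp [h0])
  · exact fun h => ⟨z, hz, h, rfl⟩

theorem isOpen_affineDomain (i : Fin (m + 1)) :
    IsOpen (affineDomain i : Set (ComplexProjectiveSpace m)) := by
  rw [← isQuotientMap_mk.isOpen_preimage]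
  have : (fun z : {z : Fin (m + 1) → ℂ // z ≠ 0} => mk z.1 z.2) ⁻¹' affineDomain i
      = {z | z.1 i ≠ 0} := by
    ext z
    exact mk_mem_affineDomain
  rw [this]
  exact isOpen_ne_fun ((continuous_apply i).comp continuous_subtype_val) continuous_const

/-- The standard affine chart `[z] ↦ (z_j / z_i)_{j ≠ i}` on the locus `z_i ≠ 0`, whose inverse
inserts the coordinate `1` in position `i`. -/
noncomputable def affineChart (i : Fin (m + 1)) :
    OpenPartialHomeomorph (ComplexProjectiveSpace m) (Fin m → ℂ) where
  toFun := affineCoord i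
  invFun w := mk (i.insertNth (α := fun _ => ℂ) 1 w) (insertNth_one_ne_zero i w)
  source := affineDomain i
  target := univ
  map_source' _ _ := mem_univ _
  map_target' w _ := by simp
  left_inv' := by
    rintro _ ⟨z, hz, hzi, rfl⟩
    rw [mk_eq_mk_iff]
    refine ⟨(z i)⁻¹, ?_⟩
    ext j
    refine Fin.succAboveCases i ?_ (fun j => ?_) j
    · simp [hzi]
    · simp [div_eq_inv_mul]
  right_inv' w _ := by
    ext j
    simp
  open_source := isOpen_affineDomain i
  open_target := isOpen_univ
  continuousOn_toFun := by
    rw [isQuotientMap_mk.continuousOn_isOpen_iff (isOpen_affineDomain i)]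
    refine continuousOn_pi.2 fun j => ?_
    refine ContinuousOn.div ?_ ?_ ?_
    · exact ((continuous_apply _).comp continuous_subtype_val).continuousOn
    · exact ((continuous_apply _).comp continuous_subtype_val).continuousOn
    · intro z hz
      exact mk_mem_affineDomain.1 hz
  continuousOn_invFun := by
    refine Continuous.continuousOn ?_
    have h : Continuous fun w : Fin m → ℂ => i.insertNth (α := fun _ => ℂ) 1 w :=
      Continuous.finInsertNth i continuous_const continuous_id
    exact isQuotientMap_mk.continuous.comp (h.subtype_mk (insertNth_one_ne_zero i))

theorem exists_mem_affineDomain (p : ComplexProjectiveSpace m) : ∃ i, p ∈ affineDomain i := by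
  obtain ⟨⟨z, hz⟩, rfl⟩ := isQuotientMap_mk.surjective p
  obtain ⟨i, hi⟩ := Function.ne_iff.1 hz
  exact ⟨i, mk_mem_affineDomain.2 hi⟩

/-- The standard atlas of affine charts. -/
noncomputable instance : ChartedSpace (Fin m → ℂ) (ComplexProjectiveSpace m) where
  atlas := range affineChart
  chartAt p := affineChart (exists_mem_affineDomain p).choose
  mem_chart_source p := (exists_mem_affineDomain p).choose_spec
  chart_mem_atlas _ := mem_range_self _

theorem contDiffOn_transition (i i' : Fin (m + 1)) :
    ContDiffOn ℂ ω ((affineChart i).symm ≫ₕ affineChart i')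
      ((affineChart i).symm ≫ₕ affineChart i').source := by
  have key : ∀ j : Fin (m + 1),
      ContDiff ℂ ω fun w : Fin m → ℂ => i.insertNth (α := fun _ => ℂ) 1 w j := by
    intro j
    refine Fin.succAboveCases i ?_ (fun j => ?_) j
    · simpa using contDiff_const
    · simpa using contDiff_apply ℂ ℂ j
  refine contDiffOn_pi.2 fun j => ?_
  refine ContDiffOn.div (key _).contDiffOn (key _).contDiffOn ?_
  rintro w ⟨_, hw⟩
  exact mk_mem_affineDomain.1 hw

/-- Complex projective space is a smooth manifold of real dimension `2 m`. -/
instance : IsManifold 𝓘(ℝ, Fin m → ℂ) ∞ (ComplexProjectiveSpace m) := by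
  refine isManifold_of_contDiffOn _ _ _ ?_
  rintro _ _ ⟨i, rfl⟩ ⟨i', rfl⟩
  have := ((contDiffOn_transition i i').restrict_scalars ℝ).of_le (m := ∞) le_top
  simpa using this

end ComplexProjectiveSpace

/-- An orientation of an `n`-dimensional smooth manifold `M`, possibly with boundary: an orientation
of every tangent space that is locally constant in the trivializations of the tangent bundle given
by charts. -/
structure ManifoldOrientation {E H : Type*} [NormedAddCommGroup E] [NormedSpace ℝ E]
    [TopologicalSpace H] (I : ModelWithCorners ℝ E H) (n : ℕ)
    (M : Type*) [TopologicalSpace M] [ChartedSpace H M] [IsManifold I ∞ M] where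
  /-- The orientation of the tangent space at `x`. -/
  orientationAt : ∀ x : M, Orientation ℝ (TangentSpace I x) (Fin n)
  locallyConstant : ∀ x₀ : M, ∀ᶠ x in 𝓝 x₀,
    ∃ hx : x ∈ (trivializationAt E (TangentSpace I) x₀).baseSet,
      Orientation.map (Fin n)
        ((trivializationAt E (TangentSpace I) x₀).continuousLinearEquivAt ℝ x hx).toLinearEquiv
        (orientationAt x) = orientationAt x₀

/-- The real basis `e_1, i e_1, …, e_m, i e_m` of `ℂ ^ m`. -/
noncomputable def complexRealBasis (m : ℕ) : Basis (Fin (2 * m)) ℝ (Fin m → ℂ) :=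
  (Pi.basis fun _ : Fin m => Complex.basisOneI).reindex
    (((Equiv.sigmaEquivProd (Fin m) (Fin 2)).trans finProdFinEquiv).trans
      (finCongr (mul_comm m 2)))

namespace ComplexProjectiveSpace

variable {m : ℕ}

theorem exists_complexLinear_tangentCoordChange {x x₀ : ComplexProjectiveSpace m}
    (hx : x ∈ (chartAt (Fin m → ℂ) x₀).source) :
    ∃ L : (Fin m → ℂ) →L[ℂ] (Fin m → ℂ),
      tangentCoordChange 𝓘(ℝ, Fin m → ℂ) x x₀ x = L.restrictScalars ℝ := by
  obtain ⟨i, hi⟩ : chartAt (Fin m → ℂ) x ∈ range affineChart := chart_mem_atlas _ x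
  obtain ⟨i₀, hi₀⟩ : chartAt (Fin m → ℂ) x₀ ∈ range affineChart := chart_mem_atlas _ x₀
  have hxx := mem_chart_source (Fin m → ℂ) x
  have hd := (contDiffOn_transition i i₀).differentiableOn (by simp)
  have hs : chartAt (Fin m → ℂ) x x ∈ ((affineChart i).symm ≫ₕ affineChart i₀).source := by
    rw [hi, hi₀]
    simp only [OpenPartialHomeomorph.trans_source, OpenPartialHomeomorph.symm_source, mem_inter_iff,
      mem_preimage]
    exact ⟨(chartAt (Fin m → ℂ) x).map_source hxx, by
      rwa [(chartAt (Fin m → ℂ) x).left_inv hxx]⟩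
  have hat := (hd.differentiableAt
    (((affineChart i).symm ≫ₕ affineChart i₀).open_source.mem_nhds hs)).hasFDerivAt
  refine ⟨fderiv ℂ ((affineChart i).symm ≫ₕ affineChart i₀) (chartAt (Fin m → ℂ) x x), ?_⟩
  have h1 := hat.restrictScalars ℝ
  have h2 := hasFDerivWithinAt_tangentCoordChange (I := 𝓘(ℝ, Fin m → ℂ)) (x := x) (y := x₀) (z := x)
    (by simpa using hx)
  rw [ModelWithCorners.range_eq_univ, hasFDerivWithinAt_univ] at h2
  rw [hi, hi₀] at h1 ⊢
  exact h2.unique h1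

theorem orientation_map_eq {x x₀ : ComplexProjectiveSpace m}
    (f : (Fin m → ℂ) ≃ₗ[ℝ] (Fin m → ℂ))
    (hx : x ∈ (chartAt (Fin m → ℂ) x₀).source)
    (hf : ∀ v, f v = tangentCoordChange 𝓘(ℝ, Fin m → ℂ) x x₀ x v) :
    Orientation.map (Fin (2 * m)) f (complexRealBasis m).orientation
      = (complexRealBasis m).orientation := by
  obtain ⟨L, hL⟩ := exists_complexLinear_tangentCoordChange hx
  rw [← Basis.orientation_map, Basis.orientation_comp_linearEquiv_eq_iff_det_pos]
  have hfL : (f : (Fin m → ℂ) →ₗ[ℝ] (Fin m → ℂ)) =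
      (L : (Fin m → ℂ) →ₗ[ℂ] (Fin m → ℂ)).restrictScalars ℝ :=
    LinearMap.ext fun v => (hf v).trans (DFunLike.congr_fun hL v)
  have hne := (LinearEquiv.isUnit_det' f).ne_zero
  refine lt_of_le_of_ne ?_ hne.symm
  rw [hfL, LinearMap.det_restrictScalars, Algebra.norm_complex_apply]
  exact Complex.normSq_nonneg _

/-- The orientation of complex projective space induced by its complex structure. -/
noncomputable def complexOrientation (m : ℕ) :
    ManifoldOrientation 𝓘(ℝ, Fin m → ℂ) (2 * m) (ComplexProjectiveSpace m) where
  orientationAt _ := (complexRealBasis m).orientation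
  locallyConstant x₀ := by
    have hmem := (trivializationAt (Fin m → ℂ)
      (TangentSpace 𝓘(ℝ, Fin m → ℂ) (M := ComplexProjectiveSpace m)) x₀).open_baseSet.mem_nhds
        (FiberBundle.mem_baseSet_trivializationAt' x₀)
    filter_upwards [hmem] with x hx
    refine ⟨hx, ?_⟩
    have hx' : x ∈ (chartAt (Fin m → ℂ) x₀).source := hx
    refine orientation_map_eq (x := x) (x₀ := x₀) _ hx' fun v => ?_
    have h := TangentBundle.continuousLinearMapAt_trivializationAt_eq_core
      (I := 𝓘(ℝ, Fin m → ℂ)) hx'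
    have h2 := Bundle.Trivialization.coe_continuousLinearEquivAt_eq (R := ℝ)
      (trivializationAt (Fin m → ℂ)
      (TangentSpace 𝓘(ℝ, Fin m → ℂ) (M := ComplexProjectiveSpace m)) x₀) hx
    exact (congrFun h2 v).trans (DFunLike.congr_fun h v)

end ComplexProjectiveSpace

/-- At a boundary point `x` of a manifold modelled on the half-space `{y | 0 ≤ y 0}`, a tangent
vector points outward if its `0`-th coordinate in the chart at `x` is negative. -/
def IsOutwardPointing {d : ℕ} {W : Type*} [TopologicalSpace W]
    [ChartedSpace (EuclideanHalfSpace (d + 1)) W] {x : W}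
    (w : TangentSpace (𝓡∂ (d + 1)) x) : Prop :=
  (show EuclideanSpace ℝ (Fin (d + 1)) from w) 0 < 0

/-- The map `ι : N → W` identifies the oriented `d`-manifold `N` with the oriented boundary of the
oriented `(d + 1)`-manifold with boundary `W`: it is a smooth embedding onto `∂W`, and it preserves
orientations when `∂W` has the boundary orientation (outward vector first). -/
structure IsOrientedBoundary {d : ℕ} {E H : Type*} [NormedAddCommGroup E] [NormedSpace ℝ E]
    [TopologicalSpace H] {I : ModelWithCorners ℝ E H}
    {N : Type*} [TopologicalSpace N] [ChartedSpace H N] [IsManifold I ∞ N]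
    {W : Type*} [TopologicalSpace W] [ChartedSpace (EuclideanHalfSpace (d + 1)) W]
    [IsManifold (𝓡∂ (d + 1)) ∞ W]
    (oN : ManifoldOrientation I d N) (oW : ManifoldOrientation (𝓡∂ (d + 1)) (d + 1) W)
    (ι : N → W) : Prop where
  isSmoothEmbedding : Manifold.IsSmoothEmbedding I (𝓡∂ (d + 1)) ∞ ι
  range_eq : range ι = (𝓡∂ (d + 1)).boundary W
  orientation_eq : ∀ (p : N) (b : Basis (Fin d) ℝ (TangentSpace I p)),
    b.orientation = oN.orientationAt p →
    ∀ w : TangentSpace (𝓡∂ (d + 1)) (ι p), IsOutwardPointing w →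
      ∃ c : Basis (Fin (d + 1)) ℝ (TangentSpace (𝓡∂ (d + 1)) (ι p)),
        c 0 = w ∧ (∀ j : Fin d, c j.succ = mfderiv I (𝓡∂ (d + 1)) ι p (b j)) ∧
          c.orientation = oW.orientationAt (ι p)

/-!
The quaternionic structure `J` of `ℂ ^ (2k)` induces an antiholomorphic involution `τ [z] = [J z]`
of `ℂP^(2k-1)`. It has no fixed points: `J z = a z` would give `-z = J² z = |a|² z`
(`conjInvolution_ne_self`). Let `W` be the quotient of the cylinder `ℂP^(2k-1) × [0, 2]` by the free
involution `(p, s) ↦ (τ p, 2 - s)`; this is the `[-1, 1]`-bundle over `ℂP^(2k-1) / τ` associated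
with the double covering. The involution exchanges the two ends of the cylinder, so the boundary of
`W` is a single copy of `ℂP^(2k-1)`, the image of the end `s = 0`.

A chart of `W` is given by an affine chart of `ℂP^(2k-1)` and an open set `U` disjoint from `τ U`:
the part `U × [0, 2)` of the cylinder injects into `W`, and the coordinates are the height `s` and
the affine coordinates (`TwistedCylinder.chart`). Two such charts differ by `(s, w) ↦ (s, g w)` with
`g` holomorphic, or by `(s, w) ↦ (2 - s, g w)` with `g` antiholomorphic. In complex dimension `m`,
the Jacobian of an antiholomorphic map has the sign `(-1) ^ m`; as `m = 2k - 1` is odd, it cancels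
the sign of `s ↦ 2 - s`, and all coordinate changes preserve orientation
(`TwistedCylinder.exists_transition`). Hence `W` is orientable although `τ` reverses orientation.

At the boundary the charts of `W` restrict to affine charts of `ℂP^(2k-1)`, so the boundary
inclusion is `w ↦ (0, w)` up to a holomorphic coordinate change. An outward vector has
negative height, and therefore, followed by a complex frame, it is a negative frame of Euclidean
space (`exists_basis_orientation_eq_neg`): `W` is given the orientation opposite to that of its charts.
-/

namespace ComplexProjectiveSpace

variable {m : ℕ}

/-! ### The topology of complex projective space -/

theorem isOpenQuotientMap_mk :
    IsOpenQuotientMap (fun z : {z : Fin (m + 1) → ℂ // z ≠ 0} => mk z.1 z.2) where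
  surjective := isQuotientMap_mk.surjective
  continuous := isQuotientMap_mk.continuous
  isOpenMap U hU := by
    rw [← isQuotientMap_mk.isOpen_preimage]
    -- the saturation of `U` is the union of its scalar multiples
    have : (fun z : {z : Fin (m + 1) → ℂ // z ≠ 0} => mk z.1 z.2) ⁻¹'
        ((fun z : {z : Fin (m + 1) → ℂ // z ≠ 0} => mk z.1 z.2) '' U)
        = ⋃ a : {a : ℂ // a ≠ 0},
          (fun z : {z : Fin (m + 1) → ℂ // z ≠ 0} =>
            (⟨a.1 • z.1, smul_ne_zero a.2 z.2⟩ : {z : Fin (m + 1) → ℂ // z ≠ 0})) ⁻¹' U := by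
      ext z
      simp only [mem_preimage, mem_image, mem_iUnion]
      constructor
      · rintro ⟨w, hw, h⟩
        obtain ⟨a, ha⟩ := (mk_eq_mk_iff w.2 z.2).1 h
        have ha0 : a ≠ 0 := by
          rintro rfl
          exact w.2 (by simpa using ha.symm)
        refine ⟨⟨a, ha0⟩, ?_⟩
        convert hw
      · rintro ⟨a, ha⟩
        exact ⟨_, ha, (mk_eq_mk_iff _ _).2 ⟨a.1, rfl⟩⟩
    rw [this]
    refine isOpen_iUnion fun a => hU.preimage ?_
    exact (continuous_subtype_val.const_smul a.1).subtype_mk _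

instance : SecondCountableTopology (ComplexProjectiveSpace m) :=
  isQuotientMap_mk.secondCountableTopology isOpenQuotientMap_mk.isOpenMap

instance : T2Space (ComplexProjectiveSpace m) := by
  rw [t2Space_iff_of_isOpenQuotientMap isOpenQuotientMap_mk]
  -- proportionality is given by the vanishing of the `2 × 2` minors
  have : {q : {z : Fin (m + 1) → ℂ // z ≠ 0} × {z : Fin (m + 1) → ℂ // z ≠ 0} |
      mk q.1.1 q.1.2 = mk q.2.1 q.2.2} =
      ⋂ i, ⋂ j, {q | q.1.1 i * q.2.1 j = q.1.1 j * q.2.1 i} := by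
    ext ⟨z, w⟩
    simp only [mem_ofPred_eq, mem_iInter]
    rw [mk_eq_mk_iff]
    constructor
    · rintro ⟨a, ha⟩ i j
      simp only [← ha, Pi.smul_apply, smul_eq_mul]
      ring
    · intro h
      obtain ⟨i, hi⟩ := Function.ne_iff.1 w.2
      have hi : w.1 i ≠ 0 := hi
      refine ⟨z.1 i / w.1 i, funext fun j => ?_⟩
      simp only [Pi.smul_apply, smul_eq_mul]
      rw [div_mul_eq_mul_div, div_eq_iff hi, h i j]
  rw [this]
  have hcoord (i : Fin (m + 1)) : Continuous fun z : {z : Fin (m + 1) → ℂ // z ≠ 0} => z.1 i :=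
    (continuous_apply i).comp continuous_subtype_val
  exact isClosed_iInter fun i => isClosed_iInter fun j => isClosed_eq
    (((hcoord i).comp continuous_fst).mul ((hcoord j).comp continuous_snd))
    (((hcoord j).comp continuous_fst).mul ((hcoord i).comp continuous_snd))

instance : CompactSpace (ComplexProjectiveSpace m) := by
  have hs : ∀ z ∈ Metric.sphere (0 : Fin (m + 1) → ℂ) 1, z ≠ 0 := by
    rintro z hz rfl
    simp at hz
  have hc : Continuous fun z : Metric.sphere (0 : Fin (m + 1) → ℂ) 1 => mk z.1 (hs z.1 z.2) :=
    isQuotientMap_mk.continuous.comp (continuous_subtype_val.subtype_mk fun z => hs z.1 z.2)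
  have hsurj : Function.Surjective
      fun z : Metric.sphere (0 : Fin (m + 1) → ℂ) 1 => mk z.1 (hs z.1 z.2) := by
    intro p
    obtain ⟨⟨z, hz⟩, rfl⟩ := isQuotientMap_mk.surjective p
    refine ⟨⟨((‖z‖⁻¹ : ℝ) : ℂ) • z, ?_⟩, (mk_eq_mk_iff _ _).2 ⟨_, rfl⟩⟩
    simp [norm_smul, norm_ne_zero_iff.2 hz]
  refine ⟨?_⟩
  rw [← hsurj.range_eq]
  exact isCompact_range hc

/-! ### The quaternionic involution -/

/-- The antilinear map `J` of `ℂ ^ (m + 1)` with `(J z)_j = (-1) ^ j * conj z_{m - j}`. It satisfies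
`J² = (-1) ^ m`, so for odd `m` it is a quaternionic structure. -/
noncomputable def quaternionic (m : ℕ) :
    (Fin (m + 1) → ℂ) →ₛₗ[starRingEnd ℂ] (Fin (m + 1) → ℂ) where
  toFun z j := (-1) ^ (j : ℕ) * starRingEnd ℂ (z j.rev)
  map_add' z w := by ext j; simp [mul_add]
  map_smul' a z := by ext j; simp; ring

theorem quaternionic_apply (z : Fin (m + 1) → ℂ) (j : Fin (m + 1)) :
    quaternionic m z j = (-1) ^ (j : ℕ) * starRingEnd ℂ (z j.rev) :=
  rfl

theorem quaternionic_quaternionic (z : Fin (m + 1) → ℂ) :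
    quaternionic m (quaternionic m z) = (-1 : ℂ) ^ m • z := by
  ext j
  have : (j : ℕ) + (j.rev : ℕ) = m := by simp [Fin.val_rev]; omega
  simp only [quaternionic_apply, map_mul, map_pow, map_neg, map_one, Complex.conj_conj,
    Fin.rev_rev, Pi.smul_apply, smul_eq_mul]
  rw [← mul_assoc, ← pow_add, this]

theorem quaternionic_injective : Function.Injective (quaternionic m) := by
  intro z w h
  have h2 := congrArg (quaternionic m) h
  rw [quaternionic_quaternionic, quaternionic_quaternionic] at h2
  exact smul_right_injective _ (pow_ne_zero m (neg_ne_zero.2 one_ne_zero)) h2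

theorem quaternionic_ne_zero {z : Fin (m + 1) → ℂ} (hz : z ≠ 0) : quaternionic m z ≠ 0 :=
  (map_ne_zero_iff _ quaternionic_injective).2 hz

/-- The antiholomorphic involution `[z] ↦ [J z]` of complex projective space. -/
noncomputable def conjInvolution (p : ComplexProjectiveSpace m) : ComplexProjectiveSpace m :=
  Projectivization.map (quaternionic m) quaternionic_injective p

theorem conjInvolution_mk (z : Fin (m + 1) → ℂ) (hz : z ≠ 0) :
    conjInvolution (mk z hz) = mk (quaternionic m z) (quaternionic_ne_zero hz) :=
  rfl

@[simp]
theorem conjInvolution_conjInvolution (p : ComplexProjectiveSpace m) :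
    conjInvolution (conjInvolution p) = p := by
  obtain ⟨⟨z, hz⟩, rfl⟩ := isQuotientMap_mk.surjective p
  simp only [conjInvolution_mk]
  exact (mk_eq_mk_iff _ _).2 ⟨_, (quaternionic_quaternionic z).symm⟩

theorem continuous_conjInvolution :
    Continuous (conjInvolution : ComplexProjectiveSpace m → ComplexProjectiveSpace m) := by
  rw [isQuotientMap_mk.continuous_iff]
  refine isQuotientMap_mk.continuous.comp
    (f := fun z : {z : Fin (m + 1) → ℂ // z ≠ 0} =>
      (⟨quaternionic m z.1, quaternionic_ne_zero z.2⟩ : {z : Fin (m + 1) → ℂ // z ≠ 0})) ?_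
  refine Continuous.subtype_mk (continuous_pi fun j => ?_) _
  exact continuous_const.mul
    (Complex.continuous_conj.comp ((continuous_apply j.rev).comp continuous_subtype_val))

/-- A fixed line would be an eigenline `J z = a z`, and then `J² z = |a|² z`, against `J² = -1`. -/
theorem conjInvolution_ne_self (hm : Odd m) (p : ComplexProjectiveSpace m) :
    conjInvolution p ≠ p := by
  obtain ⟨⟨z, hz⟩, rfl⟩ := isQuotientMap_mk.surjective p
  intro h
  obtain ⟨a, ha⟩ := (mk_eq_mk_iff (quaternionic_ne_zero hz) hz).1 h
  have h2 := quaternionic_quaternionic z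
  rw [← ha, map_smulₛₗ, ← ha, smul_smul, hm.neg_one_pow] at h2
  have h3 := smul_left_injective ℂ hz h2
  rw [mul_comm, Complex.mul_conj] at h3
  have h4 := congrArg Complex.re h3
  simp only [Complex.ofReal_re, Complex.neg_re, Complex.one_re] at h4
  linarith [Complex.normSq_nonneg a]

/-- In affine coordinates the involution is a coordinate change followed by an antilinear map. -/
theorem affineCoord_conjInvolution (i : Fin (m + 1)) (p : ComplexProjectiveSpace m) (j : Fin m) :
    affineCoord i (conjInvolution p) j =
      starRingEnd ℂ ((-1) ^ ((i.succAbove j : ℕ) + (i : ℕ)) * affineCoord i.rev p j.rev) := by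
  obtain ⟨⟨z, hz⟩, rfl⟩ := isQuotientMap_mk.surjective p
  simp only [conjInvolution_mk, affineCoord_mk, quaternionic_apply, Fin.rev_succAbove, map_mul,
    map_pow, map_neg, map_one, map_div₀, pow_add]
  have h : ((-1 : ℂ) ^ (i : ℕ))⁻¹ = (-1) ^ (i : ℕ) := by
    rw [← inv_pow]; norm_num
  rw [mul_div_mul_comm, div_eq_mul_inv ((-1 : ℂ) ^ (i.succAbove j : ℕ)), h]

theorem conjInvolution_mem_affineDomain {i : Fin (m + 1)} {p : ComplexProjectiveSpace m} :
    conjInvolution p ∈ affineDomain i ↔ p ∈ affineDomain i.rev := by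
  obtain ⟨⟨z, hz⟩, rfl⟩ := isQuotientMap_mk.surjective p
  simp [conjInvolution_mk, quaternionic_apply]

end ComplexProjectiveSpace

/-! ### Euclidean coordinates of `ℝ × ℂ ^ m` -/

/-- The real coordinates of `ℝ × ℂ ^ m`: the real line first, then the basis
`e_1, i e_1, …, e_m, i e_m` of `ℂ ^ m`. -/
noncomputable def euclideanEquivRealProdComplex (m : ℕ) :
    EuclideanSpace ℝ (Fin (2 * m + 1)) ≃L[ℝ] ℝ × (Fin m → ℂ) :=
  (EuclideanSpace.equiv (Fin (2 * m + 1)) ℝ).trans <|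
    (Fin.consEquivL ℝ fun _ : Fin (2 * m + 1) => ℝ).symm.trans <|
      (ContinuousLinearEquiv.refl ℝ ℝ).prodCongr (complexRealBasis m).equivFunL.symm

section

variable {m : ℕ}

@[simp]
theorem euclideanEquivRealProdComplex_symm_zero (q : ℝ × (Fin m → ℂ)) :
    (euclideanEquivRealProdComplex m).symm q 0 = q.1 :=
  rfl

theorem euclideanEquivRealProdComplex_symm_succ (q : ℝ × (Fin m → ℂ)) (j : Fin (2 * m)) :
    (euclideanEquivRealProdComplex m).symm q j.succ = (complexRealBasis m).repr q.2 j :=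
  rfl

end

namespace ComplexProjectiveSpace

variable {m : ℕ}

/-! ### The twisted cylinder -/

/-- The cylinder over complex projective space; its length is `2`. -/
abbrev Cylinder (m : ℕ) : Type := ComplexProjectiveSpace m × Icc (0 : ℝ) 2

namespace Cylinder

/-- The involution of the cylinder that acts by `[z] ↦ [J z]` on the base and reverses the
interval. -/
noncomputable def flip (x : Cylinder m) : Cylinder m :=
  (conjInvolution x.1, ⟨2 - x.2.1, by linarith [x.2.2.2], by linarith [x.2.2.1]⟩)

@[simp] theorem flip_fst (x : Cylinder m) : (flip x).1 = conjInvolution x.1 := rfl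

@[simp] theorem flip_snd (x : Cylinder m) : ((flip x).2 : ℝ) = 2 - x.2 := rfl

@[simp]
theorem flip_flip (x : Cylinder m) : flip (flip x) = x := by
  ext1
  · simp
  · ext; simp

theorem continuous_flip : Continuous (flip : Cylinder m → Cylinder m) := by
  refine (continuous_conjInvolution.comp continuous_fst).prodMk (Continuous.subtype_mk ?_ _)
  fun_prop

/-- The relation that identifies every point of the cylinder with its image under `flip`. -/
def flipSetoid (m : ℕ) : Setoid (Cylinder m) where
  r x y := x = y ∨ x = flip y
  iseqv :=
    { refl := fun _ => Or.inl rfl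
      symm := by
        rintro x y (rfl | rfl)
        · exact Or.inl rfl
        · exact Or.inr (flip_flip y).symm
      trans := by
        rintro x y z (rfl | rfl) (rfl | rfl)
        · exact Or.inl rfl
        · exact Or.inr rfl
        · exact Or.inr rfl
        · exact Or.inl (flip_flip z) }

/-- The chart of the cylinder with values in the half-space given by the height and the `i`-th
affine coordinates. It is defined below the upper end. -/
noncomputable def chart (i : Fin (m + 1)) :
    OpenPartialHomeomorph (Cylinder m) (EuclideanHalfSpace (2 * m + 1)) where
  toFun x := ⟨(euclideanEquivRealProdComplex m).symm (x.2, affineChart i x.1), x.2.2.1⟩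
  invFun y := ((affineChart i).symm (euclideanEquivRealProdComplex m y.1).2,
    ⟨min (y.1 0) 2, le_min y.2 zero_le_two, min_le_right _ _⟩)
  source := {x | x.1 ∈ (affineChart i).source ∧ (x.2 : ℝ) < 2}
  target := {y | y.1 0 < 2}
  map_source' _ hx := by exact hx.2
  map_target' y hy := ⟨(affineChart i).map_target (mem_univ _), (min_le_left _ _).trans_lt hy⟩
  left_inv' x hx := by
    ext1
    · simp [(affineChart i).left_inv hx.1]
    · ext
      simpa using hx.2.le
  right_inv' y hy := by
    have hy' : y.1 0 < 2 := hy
    ext1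
    simp only [(affineChart i).right_inv (mem_univ _), min_eq_left hy'.le]
    exact (euclideanEquivRealProdComplex m).symm_apply_apply y.1
  open_source := ((affineChart i).open_source.preimage continuous_fst).inter
    (isOpen_Iio.preimage (continuous_subtype_val.comp continuous_snd))
  open_target :=
    isOpen_Iio.preimage ((EuclideanSpace.proj 0).continuous.comp continuous_subtype_val)
  continuousOn_toFun := by
    refine continuousOn_iff_continuous_domRestrict.2 (Continuous.subtype_mk ?_ _)
    refine (euclideanEquivRealProdComplex m).symm.continuous.comp (Continuous.prodMk ?_ ?_)
    · exact continuous_subtype_val.comp (continuous_snd.comp continuous_subtype_val)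
    · exact continuousOn_iff_continuous_domRestrict.1 <|
        (affineChart i).continuousOn.comp continuous_fst.continuousOn fun x hx => hx.1
  continuousOn_invFun := by
    refine Continuous.continuousOn (Continuous.prodMk ?_ (Continuous.subtype_mk ?_ _))
    · exact (continuousOn_univ.1 (affineChart i).symm.continuousOn).comp <|
        continuous_snd.comp <|
          (euclideanEquivRealProdComplex m).continuous.comp continuous_subtype_val
    · exact ((EuclideanSpace.proj 0).continuous.comp continuous_subtype_val).min continuous_const

end Cylinder

/-- The twisted cylinder: the quotient of the cylinder over complex projective space by the
involution `Cylinder.flip`. -/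
def TwistedCylinder (m : ℕ) : Type := Quotient (Cylinder.flipSetoid m)

namespace TwistedCylinder

instance : TopologicalSpace (TwistedCylinder m) :=
  inferInstanceAs (TopologicalSpace (Quotient (Cylinder.flipSetoid m)))

/-- The class of a point of the cylinder. -/
def mk (x : Cylinder m) : TwistedCylinder m := Quotient.mk (Cylinder.flipSetoid m) x

theorem mk_eq_mk_iff {x y : Cylinder m} : mk x = mk y ↔ x = y ∨ x = y.flip :=
  Quotient.eq (r := Cylinder.flipSetoid m)

@[simp]
theorem mk_flip (x : Cylinder m) : mk x.flip = mk x :=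
  mk_eq_mk_iff.2 (Or.inr rfl)

theorem isOpenQuotientMap_mk : IsOpenQuotientMap (mk : Cylinder m → TwistedCylinder m) where
  surjective := Quotient.mk_surjective
  continuous := continuous_quotient_mk'
  isOpenMap U hU := by
    have : mk ⁻¹' (mk '' U) = U ∪ Cylinder.flip ⁻¹' U := by
      ext x
      simp only [mem_preimage, mem_image, mem_union]
      constructor
      · rintro ⟨y, hy, h⟩
        rcases mk_eq_mk_iff.1 h with rfl | rfl
        · exact Or.inl hy
        · exact Or.inr hy
      · rintro (h | h)
        · exact ⟨x, h, rfl⟩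
        · exact ⟨_, h, mk_flip x⟩
    exact isQuotientMap_quotient_mk'.isOpen_preimage.1
      (this ▸ hU.union (hU.preimage Cylinder.continuous_flip))

instance : SecondCountableTopology (TwistedCylinder m) :=
  isOpenQuotientMap_mk.isQuotientMap.secondCountableTopology isOpenQuotientMap_mk.isOpenMap

instance : CompactSpace (TwistedCylinder m) :=
  inferInstanceAs (CompactSpace (Quotient (Cylinder.flipSetoid m)))

instance : T2Space (TwistedCylinder m) := by
  rw [t2Space_iff_of_isOpenQuotientMap isOpenQuotientMap_mk]
  simp only [mk_eq_mk_iff, ofPred_or]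
  exact isClosed_diagonal.union
    (isClosed_eq continuous_fst (Cylinder.continuous_flip.comp continuous_snd))

/-! ### Charts of the twisted cylinder -/

/-- An open set of complex projective space that is disjoint from its image under the involution. -/
structure IsSmall (U : Set (ComplexProjectiveSpace m)) : Prop where
  isOpen : IsOpen U
  conjInvolution_notMem : ∀ p ∈ U, conjInvolution p ∉ U

theorem exists_isSmall (hm : Odd m) (p : ComplexProjectiveSpace m) : ∃ U, IsSmall U ∧ p ∈ U := by
  obtain ⟨A, B, hA, hB, hpA, hpB, hAB⟩ := t2_separation (conjInvolution_ne_self hm p).symm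
  exact ⟨A ∩ conjInvolution ⁻¹' B, ⟨hA.inter (hB.preimage continuous_conjInvolution),
    fun q hq hq' => disjoint_left.1 hAB hq'.1 hq.2⟩, hpA, hpB⟩

/-- The part of the cylinder over `U` and below the upper end. -/
def slab (U : Set (ComplexProjectiveSpace m)) : Set (Cylinder m) := {x | x.1 ∈ U ∧ (x.2 : ℝ) < 2}

theorem isOpen_slab {U : Set (ComplexProjectiveSpace m)} (hU : IsOpen U) : IsOpen (slab U) :=
  (hU.preimage continuous_fst).inter
    (isOpen_Iio.preimage (continuous_subtype_val.comp continuous_snd))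

theorem injOn_mk_slab {U : Set (ComplexProjectiveSpace m)} (hU : IsSmall U) :
    InjOn mk (slab U) := by
  intro x hx y hy h
  rcases mk_eq_mk_iff.1 h with h | rfl
  · exact h
  · exact absurd hx.1 (hU.conjInvolution_notMem _ hy.1)

instance : Nonempty (Cylinder m) :=
  ⟨(ComplexProjectiveSpace.mk (fun _ => 1) fun h => one_ne_zero (congrFun h 0),
    ⟨0, le_rfl, zero_le_two⟩)⟩

/-- The quotient map as a homeomorphism from the slab over a small open set onto its image. -/
noncomputable def slabHomeo (U : Set (ComplexProjectiveSpace m)) (hU : IsSmall U) :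
    OpenPartialHomeomorph (Cylinder m) (TwistedCylinder m) :=
  OpenPartialHomeomorph.ofContinuousOpen ((injOn_mk_slab hU).toPartialEquiv mk (slab U))
    isOpenQuotientMap_mk.continuous.continuousOn isOpenQuotientMap_mk.isOpenMap
    (isOpen_slab hU.isOpen)

theorem slabHomeo_symm_mk {U : Set (ComplexProjectiveSpace m)} (hU : IsSmall U) {x : Cylinder m}
    (hx : x ∈ slab U) : (slabHomeo U hU).symm (mk x) = x :=
  (slabHomeo U hU).left_inv hx

/-- The chart of the twisted cylinder over a small open set given by the height and the `i`-th
affine coordinates. -/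
noncomputable def chart (i : Fin (m + 1)) (U : Set (ComplexProjectiveSpace m)) (hU : IsSmall U) :
    OpenPartialHomeomorph (TwistedCylinder m) (EuclideanHalfSpace (2 * m + 1)) :=
  (slabHomeo U hU).symm ≫ₕ Cylinder.chart i

theorem mk_mem_chart_source {i : Fin (m + 1)} {U : Set (ComplexProjectiveSpace m)}
    (hU : IsSmall U) {x : Cylinder m} (hx : x ∈ slab U) (hi : x.1 ∈ affineDomain i) :
    mk x ∈ (chart i U hU).source := by
  refine ⟨⟨x, hx, rfl⟩, ?_⟩
  change (slabHomeo U hU).symm (mk x) ∈ (Cylinder.chart i).source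
  rw [slabHomeo_symm_mk hU hx]
  exact ⟨hi, hx.2⟩

theorem exists_of_mem_chart_source {i : Fin (m + 1)} {U : Set (ComplexProjectiveSpace m)}
    {hU : IsSmall U} {q : TwistedCylinder m} (hq : q ∈ (chart i U hU).source) :
    ∃ x : Cylinder m, x ∈ slab U ∧ x.1 ∈ affineDomain i ∧ mk x = q := by
  obtain ⟨⟨x, hx, rfl⟩, h⟩ := hq
  change (slabHomeo U hU).symm (mk x) ∈ (Cylinder.chart i).source at h
  rw [slabHomeo_symm_mk hU hx] at h
  exact ⟨x, hx, h.1, rfl⟩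

theorem chart_mk {i : Fin (m + 1)} {U : Set (ComplexProjectiveSpace m)}
    (hU : IsSmall U) {x : Cylinder m} (hx : x ∈ slab U) :
    chart i U hU (mk x) = Cylinder.chart i x :=
  congrArg (Cylinder.chart i) (slabHomeo_symm_mk hU hx)

theorem exists_mem_chart_source (hm : Odd m) (q : TwistedCylinder m) :
    ∃ e ∈ {e : OpenPartialHomeomorph (TwistedCylinder m) (EuclideanHalfSpace (2 * m + 1)) |
      ∃ i U hU, e = chart i U hU}, q ∈ e.source := by
  -- a representative at the upper end is replaced by the other one
  obtain ⟨x, hx, rfl⟩ : ∃ x : Cylinder m, (x.2 : ℝ) < 2 ∧ mk x = q := by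
    obtain ⟨x, rfl⟩ := isOpenQuotientMap_mk.surjective q
    by_cases hx : (x.2 : ℝ) < 2
    · exact ⟨x, hx, rfl⟩
    · exact ⟨x.flip, by rw [Cylinder.flip_snd]; linarith, mk_flip x⟩
  obtain ⟨i, hi⟩ := exists_mem_affineDomain x.1
  obtain ⟨U, hU, hxU⟩ := exists_isSmall hm x.1
  exact ⟨_, ⟨i, U, hU, rfl⟩, mk_mem_chart_source hU ⟨hxU, hx⟩ hi⟩

noncomputable instance [hm : Fact (Odd m)] :
    ChartedSpace (EuclideanHalfSpace (2 * m + 1)) (TwistedCylinder m) where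
  atlas := {e | ∃ i U hU, e = chart i U hU}
  chartAt q := (exists_mem_chart_source hm.out q).choose
  mem_chart_source q := (exists_mem_chart_source hm.out q).choose_spec.2
  chart_mem_atlas q := (exists_mem_chart_source hm.out q).choose_spec.1

end TwistedCylinder

end ComplexProjectiveSpace

/-! ### Jacobians of coordinate changes -/

/-- A complex linear map preserves the orientation given by the complex structure. -/
theorem ContinuousLinearMap.det_restrictScalars_complex_nonneg {V : Type*} [NormedAddCommGroup V]
    [NormedSpace ℂ V] (L : V →L[ℂ] V) : 0 ≤ (L.restrictScalars ℝ).det := by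
  change 0 ≤ LinearMap.det ((L : V →ₗ[ℂ] V).restrictScalars ℝ)
  rw [LinearMap.det_restrictScalars, Algebra.norm_complex_apply]
  exact Complex.normSq_nonneg _

/-- Complex conjugation of `ℂ ^ m` as a real linear map. -/
noncomputable def piConjCLM (m : ℕ) : (Fin m → ℂ) →L[ℝ] (Fin m → ℂ) :=
  ContinuousLinearMap.pi fun j => (Complex.conjCLE : ℂ →L[ℝ] ℂ) ∘L ContinuousLinearMap.proj j

theorem det_piConjCLM (m : ℕ) : (piConjCLM m).det = (-1) ^ m := by
  have h := LinearMap.det_pi (ι := Fin m) fun _ => Complex.conjAe.toLinearEquiv.toLinearMap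
  simp only [Complex.det_conjAe, Finset.prod_const, Finset.card_univ, Fintype.card_fin] at h
  exact h

/-- The map `(s, w) ↦ (a s, g w)` of `ℝ × ℂ ^ m` in Euclidean coordinates. -/
noncomputable def euclideanProdMap {m : ℕ} (a : ℝ → ℝ) (g : (Fin m → ℂ) → (Fin m → ℂ))
    (y : EuclideanSpace ℝ (Fin (2 * m + 1))) : EuclideanSpace ℝ (Fin (2 * m + 1)) :=
  (euclideanEquivRealProdComplex m).symm (a (y 0), g (euclideanEquivRealProdComplex m y).2)

section

variable {m : ℕ} {a : ℝ → ℝ} {g : (Fin m → ℂ) → (Fin m → ℂ)}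
  {y : EuclideanSpace ℝ (Fin (2 * m + 1))}

theorem contDiffAt_euclideanProdMap (ha : ContDiff ℝ ∞ a)
    (hg : ContDiffAt ℝ ∞ g (euclideanEquivRealProdComplex m y).2) :
    ContDiffAt ℝ ∞ (euclideanProdMap a g) y := by
  have hE := (euclideanEquivRealProdComplex m).contDiff (n := ∞)
  refine (euclideanEquivRealProdComplex m).symm.contDiff.contDiffAt.comp y (ContDiffAt.prodMk ?_ ?_)
  · exact (ha.comp (contDiff_fst.comp hE)).contDiffAt
  · exact hg.comp y (contDiff_snd.comp hE).contDiffAt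

theorem exists_hasFDerivAt_euclideanProdMap {α : ℝ} {G : (Fin m → ℂ) →L[ℝ] (Fin m → ℂ)}
    (ha : HasDerivAt a α (y 0)) (hg : HasFDerivAt g G (euclideanEquivRealProdComplex m y).2) :
    ∃ D, HasFDerivAt (euclideanProdMap a g) D y ∧ D.det = α * G.det := by
  set E := euclideanEquivRealProdComplex m
  let A : ℝ →L[ℝ] ℝ := ContinuousLinearMap.toSpanSingleton ℝ α
  refine ⟨(E.symm : _ →L[ℝ] _) ∘L A.prodMap G ∘L (E : _ →L[ℝ] _), ?_, ?_⟩
  · have h : HasFDerivAt (Prod.map a g) (A.prodMap G) (E y) := HasFDerivAt.prodMap (E y)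
      (show HasFDerivAt a A (E y).1 from ha.hasFDerivAt) hg
    exact E.symm.hasFDerivAt.comp y (h.comp y E.hasFDerivAt)
  · have h1 := LinearMap.det_conj
      (LinearMap.prodMap (A : ℝ →ₗ[ℝ] ℝ) (G : (Fin m → ℂ) →ₗ[ℝ] (Fin m → ℂ)))
      E.symm.toLinearEquiv
    rw [LinearMap.det_prodMap] at h1
    have h2 : LinearMap.det (A : ℝ →ₗ[ℝ] ℝ) = α := by
      rw [LinearMap.det_ring]
      simp [A]
    rw [h2] at h1
    exact h1

end

namespace ComplexProjectiveSpace

variable {m : ℕ}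

theorem contDiffAt_affineChart_transition {i i' : Fin (m + 1)} {w : Fin m → ℂ}
    (hw : (affineChart i).symm w ∈ affineDomain i') :
    ContDiffAt ℂ ω (fun v => affineChart i' ((affineChart i).symm v)) w :=
  (contDiffOn_transition i i').contDiffAt
    (((affineChart i).symm ≫ₕ affineChart i').open_source.mem_nhds ⟨mem_univ _, hw⟩)

/-- In affine coordinates, the involution is antiholomorphic. -/
theorem exists_conjInvolution_transition (i i' : Fin (m + 1)) :
    ∃ Q : (Fin m → ℂ) →L[ℂ] (Fin m → ℂ), ∀ v : Fin m → ℂ,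
      affineChart i' (conjInvolution ((affineChart i).symm v)) =
        piConjCLM m (Q (affineChart i'.rev ((affineChart i).symm v))) := by
  refine ⟨ContinuousLinearMap.pi fun j =>
    ((-1 : ℂ) ^ ((i'.succAbove j : ℕ) + (i' : ℕ))) • ContinuousLinearMap.proj j.rev,
    fun v => funext fun j => ?_⟩
  exact affineCoord_conjInvolution i' ((affineChart i).symm v) j

namespace TwistedCylinder

/-- Two charts of the twisted cylinder differ by a smooth map with nonnegative Jacobian. The
coordinate change is `(s, w) ↦ (s, g w)` with `g` holomorphic or `(s, w) ↦ (2 - s, g w)` with `g`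
antiholomorphic; in the second case the two signs `-1` and `(-1) ^ m` cancel. -/
theorem exists_transition (hm : Odd m) {i i' : Fin (m + 1)} {U U' : Set (ComplexProjectiveSpace m)}
    {hU : IsSmall U} {hU' : IsSmall U'} {y : EuclideanHalfSpace (2 * m + 1)}
    (hy : y ∈ ((chart i U hU).symm ≫ₕ chart i' U' hU').source) :
    ∃ (T : EuclideanSpace ℝ (Fin (2 * m + 1)) → EuclideanSpace ℝ (Fin (2 * m + 1)))
      (D : EuclideanSpace ℝ (Fin (2 * m + 1)) →L[ℝ] EuclideanSpace ℝ (Fin (2 * m + 1))),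
      ContDiffAt ℝ ∞ T y.1 ∧ HasFDerivAt T D y.1 ∧ 0 ≤ D.det ∧
      (𝓡∂ (2 * m + 1)) ∘ (chart i' U' hU' ∘ (chart i U hU).symm) ∘ (𝓡∂ (2 * m + 1)).symm
        =ᶠ[𝓝[range (𝓡∂ (2 * m + 1))] y.1] T := by
  obtain ⟨⟨hy2, hyU⟩, hy'⟩ := hy
  obtain ⟨x', hx', hi', h⟩ := exists_of_mem_chart_source hy'
  have hcont : ContinuousAt (Cylinder.chart i).symm y := (Cylinder.chart i).continuousAt_symm hy2
  have hlt : ∀ᶠ y' : EuclideanHalfSpace (2 * m + 1) in 𝓝 y, y'.1 0 < 2 :=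
    (Cylinder.chart i).open_target.mem_nhds hy2
  -- neighbourhoods in the model space and in its range correspond
  have hmap := (𝓡∂ (2 * m + 1)).map_nhds_eq y
  rcases mk_eq_mk_iff.1 h with h | h
  · subst h
    have hdiff := contDiffAt_affineChart_transition hi'
    obtain ⟨D, hD, hdet⟩ := exists_hasFDerivAt_euclideanProdMap (y := y.1) (hasDerivAt_id (y.1 0))
      ((hdiff.differentiableAt (by simp)).hasFDerivAt.restrictScalars ℝ)
    refine ⟨_, D, contDiffAt_euclideanProdMap contDiff_id
      ((hdiff.restrict_scalars ℝ).of_le le_top), hD, ?_, ?_⟩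
    · rw [hdet, one_mul]
      exact ContinuousLinearMap.det_restrictScalars_complex_nonneg _
    · change _ =ᶠ[𝓝[_] ((𝓡∂ (2 * m + 1)) y)] _
      rw [← hmap, EventuallyEq, eventually_map]
      filter_upwards [hcont.preimage_mem_nhds ((isOpen_slab hU'.isOpen).mem_nhds hx'), hlt]
        with y' h1 h2
      simp only [Function.comp_apply, ModelWithCorners.left_inv]
      change (chart i' U' hU' (mk ((Cylinder.chart i).symm y'))).1 = _
      rw [chart_mk hU' h1]
      change (euclideanEquivRealProdComplex m).symm (min (y'.1 0) 2, _) = _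
      rw [min_eq_left h2.le]
      rfl
  · subst h
    obtain ⟨Q, hQ⟩ := exists_conjInvolution_transition i i'
    have hdiff := Q.contDiff.contDiffAt.comp _ <|
      contDiffAt_affineChart_transition (conjInvolution_mem_affineDomain.1 hi')
    obtain ⟨D, hD, hdet⟩ := exists_hasFDerivAt_euclideanProdMap (y := y.1)
      ((hasDerivAt_id (y.1 0)).const_sub 2)
      ((piConjCLM m).hasFDerivAt.comp _
        ((hdiff.differentiableAt (by simp)).hasFDerivAt.restrictScalars ℝ))
    refine ⟨_, D, contDiffAt_euclideanProdMap (contDiff_const.sub contDiff_id)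
      ((piConjCLM m).contDiff.contDiffAt.comp _ ((hdiff.restrict_scalars ℝ).of_le le_top)),
      hD, ?_, ?_⟩
    · rw [hdet, ContinuousLinearMap.det, ContinuousLinearMap.toLinearMap_comp, LinearMap.det_comp]
      change 0 ≤ -1 * ((piConjCLM m).det * _)
      rw [det_piConjCLM, hm.neg_one_pow, neg_one_mul, neg_one_mul, neg_neg]
      exact ContinuousLinearMap.det_restrictScalars_complex_nonneg _
    · change _ =ᶠ[𝓝[_] ((𝓡∂ (2 * m + 1)) y)] _
      rw [← hmap, EventuallyEq, eventually_map]
      filter_upwards [(Cylinder.continuous_flip.continuousAt.comp hcont).preimage_mem_nhds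
        ((isOpen_slab hU'.isOpen).mem_nhds hx'), hlt] with y' h1 h2
      simp only [Function.comp_apply, ModelWithCorners.left_inv]
      change (chart i' U' hU' (mk ((Cylinder.chart i).symm y'))).1 = _
      rw [← mk_flip, chart_mk hU' (x := Cylinder.flip ((Cylinder.chart i).symm y')) h1]
      change (euclideanEquivRealProdComplex m).symm (2 - min (y'.1 0) 2, affineChart i'
        (conjInvolution ((affineChart i).symm (euclideanEquivRealProdComplex m y'.1).2))) = _
      rw [min_eq_left h2.le, hQ]
      rfl

variable [hm : Fact (Odd m)]

instance : IsManifold (𝓡∂ (2 * m + 1)) ∞ (TwistedCylinder m) := by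
  refine isManifold_of_contDiffOn _ _ _ ?_
  rintro _ _ ⟨i, U, hU, rfl⟩ ⟨i', U', hU', rfl⟩
  rintro _ ⟨hy, ⟨y, rfl⟩⟩
  rw [mem_preimage, ModelWithCorners.left_inv] at hy
  obtain ⟨T, D, hT, -, -, h⟩ := exists_transition hm.out hy
  have h' := hT.contDiffWithinAt (s := range (𝓡∂ (2 * m + 1)))
  exact (h'.congr_of_eventuallyEq h (h.self_of_nhdsWithin (mem_range_self y))).mono
    inter_subset_right

theorem exists_chartAt_eq (q : TwistedCylinder m) :
    ∃ i U hU, chartAt (EuclideanHalfSpace (2 * m + 1)) q = chart i U hU :=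
  (exists_mem_chart_source hm.out q).choose_spec.1

theorem det_tangentCoordChange_nonneg {q q₀ : TwistedCylinder m}
    (hq : q ∈ (chartAt (EuclideanHalfSpace (2 * m + 1)) q₀).source) :
    0 ≤ (tangentCoordChange (𝓡∂ (2 * m + 1)) q q₀ q).det := by
  obtain ⟨i, U, hU, he⟩ := exists_chartAt_eq q
  obtain ⟨i₀, U₀, hU₀, he₀⟩ := exists_chartAt_eq q₀
  have hqq := mem_chart_source (EuclideanHalfSpace (2 * m + 1)) q
  have hder := hasFDerivWithinAt_tangentCoordChange (I := 𝓡∂ (2 * m + 1)) (x := q) (y := q₀)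
    (z := q) ⟨by simp, by simpa using hq⟩
  have hy : chart i U hU q ∈ ((chart i U hU).symm ≫ₕ chart i₀ U₀ hU₀).source := by
    rw [he] at hqq
    rw [he₀] at hq
    refine ⟨(chart i U hU).map_source hqq, ?_⟩
    change (chart i U hU).symm (chart i U hU q) ∈ (chart i₀ U₀ hU₀).source
    rwa [(chart i U hU).left_inv hqq]
  obtain ⟨T, D, -, hD, hdet, h⟩ := exists_transition hm.out hy
  simp only [extChartAt, he, he₀] at hder
  have hD' := hD.hasFDerivWithinAt.congr_of_eventuallyEq h
    (h.self_of_nhdsWithin (mem_range_self (f := 𝓡∂ (2 * m + 1)) (chart i U hU q)))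
  rwa [UniqueDiffWithinAt.eq ((𝓡∂ (2 * m + 1)).uniqueDiffWithinAt_image) hder hD']

/-- The orientation of the twisted cylinder that is opposite to the standard orientation in every
chart. The height decreases in the outward direction at the boundary, which is the reason for the
sign. -/
noncomputable def orientation (m : ℕ) [Fact (Odd m)] :
    ManifoldOrientation (𝓡∂ (2 * m + 1)) (2 * m + 1) (TwistedCylinder m) where
  orientationAt _ := -(EuclideanSpace.basisFun (Fin (2 * m + 1)) ℝ).toBasis.orientation
  locallyConstant q₀ := by
    have hmem := (trivializationAt (EuclideanSpace ℝ (Fin (2 * m + 1)))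
      (TangentSpace (𝓡∂ (2 * m + 1)) (M := TwistedCylinder m)) q₀).open_baseSet.mem_nhds
        (FiberBundle.mem_baseSet_trivializationAt' q₀)
    filter_upwards [hmem] with q hq
    refine ⟨hq, ?_⟩
    have hq' : q ∈ (chartAt (EuclideanHalfSpace (2 * m + 1)) q₀).source := hq
    have h := TangentBundle.continuousLinearMapAt_trivializationAt_eq_core
      (I := 𝓡∂ (2 * m + 1)) hq'
    have h2 := Bundle.Trivialization.coe_continuousLinearEquivAt_eq (R := ℝ)
      (trivializationAt (EuclideanSpace ℝ (Fin (2 * m + 1)))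
      (TangentSpace (𝓡∂ (2 * m + 1)) (M := TwistedCylinder m)) q₀) hq
    have key : ∀ f : EuclideanSpace ℝ (Fin (2 * m + 1)) ≃ₗ[ℝ] EuclideanSpace ℝ (Fin (2 * m + 1)),
        (∀ v, f v = tangentCoordChange (𝓡∂ (2 * m + 1)) q q₀ q v) →
        Orientation.map (Fin (2 * m + 1)) f
          (-(EuclideanSpace.basisFun (Fin (2 * m + 1)) ℝ).toBasis.orientation) =
          -(EuclideanSpace.basisFun (Fin (2 * m + 1)) ℝ).toBasis.orientation := by
      intro f hf
      rw [Orientation.map_neg, ← Basis.orientation_map]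
      refine congrArg _ ((Basis.orientation_comp_linearEquiv_eq_iff_det_pos _ f).2 ?_)
      have hfL :
          (f : EuclideanSpace ℝ (Fin (2 * m + 1)) →ₗ[ℝ] EuclideanSpace ℝ (Fin (2 * m + 1))) =
          (tangentCoordChange (𝓡∂ (2 * m + 1)) q q₀ q : _ →L[ℝ] _) := LinearMap.ext hf
      refine lt_of_le_of_ne ?_ (LinearEquiv.isUnit_det' f).ne_zero.symm
      rw [hfL]
      exact det_tangentCoordChange_nonneg hq'
    exact key _ fun v => (congrFun h2 v).trans (DFunLike.congr_fun h v)

end TwistedCylinder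

end ComplexProjectiveSpace

/-! ### The boundary -/

/-- A vector with negative height followed by a positive frame of `ℂ ^ m` is a negative frame of
Euclidean space. -/
theorem exists_basis_orientation_eq_neg {m : ℕ} (b : Basis (Fin (2 * m)) ℝ (Fin m → ℂ))
    (hb : b.orientation = (complexRealBasis m).orientation)
    {L : (Fin m → ℂ) →L[ℝ] (Fin m → ℂ)} (hL : 0 < L.det)
    {w : EuclideanSpace ℝ (Fin (2 * m + 1))} (hw : w 0 < 0) :
    ∃ c : Basis (Fin (2 * m + 1)) ℝ (EuclideanSpace ℝ (Fin (2 * m + 1))), c 0 = w ∧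
      (∀ j : Fin (2 * m), c j.succ = (euclideanEquivRealProdComplex m).symm (0, L (b j))) ∧
      c.orientation = -(EuclideanSpace.basisFun (Fin (2 * m + 1)) ℝ).toBasis.orientation := by
  set e := (EuclideanSpace.basisFun (Fin (2 * m + 1)) ℝ).toBasis with he
  let v : Fin (2 * m + 1) → EuclideanSpace ℝ (Fin (2 * m + 1)) :=
    Fin.cons w fun j => (euclideanEquivRealProdComplex m).symm (0, L (b j))
  have hv : ∀ i j, e.toMatrix v i j = v j i := fun i j => by simp [he, Basis.toMatrix_apply]
  have hsub : (e.toMatrix v).submatrix Fin.succ (Fin.succAbove 0) =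
      (complexRealBasis m).toMatrix (L ∘ b) := by
    ext i j
    rw [Matrix.submatrix_apply, hv]
    simp only [v, Fin.succAbove_zero, Fin.cons_succ, euclideanEquivRealProdComplex_symm_succ]
    rfl
  have hdet : e.det v < 0 := by
    -- the frame in `ℂ ^ m` has height zero, so only one term of the expansion along the first
    -- row is nonzero
    rw [Basis.det_apply, Matrix.det_succ_row_zero, Fin.sum_univ_succ, hsub, ← Basis.det_apply,
      Finset.sum_eq_zero fun j _ => ?_]
    · have h1 : (complexRealBasis m).det (L ∘ b) = L.det * (complexRealBasis m).det b :=
        Basis.det_comp _ (L : (Fin m → ℂ) →ₗ[ℝ] (Fin m → ℂ)) _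
      have h2 := (Basis.orientation_eq_iff_det_pos _ _).1 hb.symm
      rw [h1, hv]
      simp only [v, Fin.cons_zero, Fin.val_zero, pow_zero, one_mul, add_zero]
      exact mul_neg_of_neg_of_pos hw (mul_pos hL h2)
    · rw [hv]
      simp [v]
  obtain ⟨hli, hsp⟩ := e.is_basis_iff_det.2 hdet.ne.isUnit
  refine ⟨Basis.mk hli hsp.ge, ?_, fun j => ?_, ?_⟩
  · simp [v]
  · simp [v]
  · refine (e.orientation_ne_iff_eq_neg _).1 fun h => ?_
    have := (e.orientation_eq_iff_det_pos _).1 h.symm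
    rw [Basis.coe_mk] at this
    exact lt_asymm hdet this

namespace ComplexProjectiveSpace

variable {m : ℕ}

/-- The coordinate changes of complex projective space are complex differentiable and invertible, so
their Jacobians are positive. -/
theorem exists_hasFDerivAt_affineChart_transition {i i' : Fin (m + 1)} {w : Fin m → ℂ}
    (hw : (affineChart i).symm w ∈ affineDomain i') :
    ∃ L : (Fin m → ℂ) →L[ℝ] (Fin m → ℂ),
      HasFDerivAt (fun v => affineChart i' ((affineChart i).symm v)) L w ∧ 0 < L.det := by
  have hL := ((contDiffAt_affineChart_transition hw).differentiableAt (by simp)).hasFDerivAt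
  set w' := affineChart i' ((affineChart i).symm w)
  have hw' : (affineChart i').symm w' = (affineChart i).symm w := (affineChart i').left_inv hw
  have hwi : (affineChart i').symm w' ∈ affineDomain i :=
    hw' ▸ (affineChart i).map_target (mem_univ w)
  have hL' := ((contDiffAt_affineChart_transition hwi).differentiableAt (by simp)).hasFDerivAt
  refine ⟨_, hL.restrictScalars ℝ, lt_of_le_of_ne
    (ContinuousLinearMap.det_restrictScalars_complex_nonneg _) fun h0 => ?_⟩
  -- the opposite coordinate change is a left inverse
  have hid : (fun v => affineChart i ((affineChart i').symm v)) ∘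
      (fun v => affineChart i' ((affineChart i).symm v)) =ᶠ[𝓝 w] id := by
    filter_upwards [((affineChart i).symm ≫ₕ affineChart i').open_source.mem_nhds
      ⟨mem_univ w, hw⟩] with v hv
    have hv' : (affineChart i').symm (affineChart i' ((affineChart i).symm v)) =
      (affineChart i).symm v := (affineChart i').left_inv hv.2
    simp only [Function.comp_apply, hv', id]
    exact (affineChart i).right_inv (mem_univ v)
  have hcomp := ((hL'.restrictScalars ℝ).comp w (hL.restrictScalars ℝ)).unique
    ((hasFDerivAt_id w).congr_of_eventuallyEq hid)
  have h1 := congrArg ContinuousLinearMap.det hcomp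
  rw [ContinuousLinearMap.det, ContinuousLinearMap.toLinearMap_comp, LinearMap.det_comp] at h1
  change _ * ContinuousLinearMap.det _ = _ at h1
  rw [← h0, mul_zero] at h1
  exact zero_ne_one (h1.trans LinearMap.det_id)

namespace TwistedCylinder

/-- The inclusion of complex projective space as the common image of the two ends of the
cylinder. -/
def boundaryInclusion (p : ComplexProjectiveSpace m) : TwistedCylinder m :=
  mk (p, ⟨0, le_rfl, zero_le_two⟩)

theorem continuous_boundaryInclusion :
    Continuous (boundaryInclusion : ComplexProjectiveSpace m → TwistedCylinder m) :=
  isOpenQuotientMap_mk.continuous.comp (continuous_id.prodMk continuous_const)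

/-- A representative of a boundary point below the upper end lies on the lower end. -/
theorem eq_of_mk_eq_boundaryInclusion {p : ComplexProjectiveSpace m} {x : Cylinder m}
    (hx : (x.2 : ℝ) < 2) (h : mk x = boundaryInclusion p) : x = (p, ⟨0, le_rfl, zero_le_two⟩) := by
  rcases mk_eq_mk_iff.1 h with rfl | rfl
  · rfl
  · simp at hx

theorem boundaryInclusion_injective :
    Function.Injective (boundaryInclusion : ComplexProjectiveSpace m → TwistedCylinder m) :=
  fun p _ h => congrArg Prod.fst <|
    eq_of_mk_eq_boundaryInclusion (x := (p, ⟨0, le_rfl, zero_le_two⟩)) zero_lt_two h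

theorem mem_of_boundaryInclusion_mem_chart_source {i : Fin (m + 1)}
    {U : Set (ComplexProjectiveSpace m)} {hU : IsSmall U} {p : ComplexProjectiveSpace m}
    (hp : boundaryInclusion p ∈ (chart i U hU).source) : p ∈ U ∧ p ∈ affineDomain i := by
  obtain ⟨x, hx, hi, h⟩ := exists_of_mem_chart_source hp
  obtain rfl := eq_of_mk_eq_boundaryInclusion hx.2 h
  exact ⟨hx.1, hi⟩

theorem chart_boundaryInclusion {i : Fin (m + 1)} {U : Set (ComplexProjectiveSpace m)}
    (hU : IsSmall U) {p : ComplexProjectiveSpace m} (hp : p ∈ U) :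
    (chart i U hU (boundaryInclusion p)).1 =
      (euclideanEquivRealProdComplex m).symm (0, affineChart i p) :=
  congrArg Subtype.val (chart_mk hU (x := (p, _)) ⟨hp, zero_lt_two⟩)

variable [hm : Fact (Odd m)]

theorem isImmersion_boundaryInclusion :
    Manifold.IsImmersion 𝓘(ℝ, Fin m → ℂ) (𝓡∂ (2 * m + 1)) ∞
      (boundaryInclusion : ComplexProjectiveSpace m → TwistedCylinder m) := by
  refine Manifold.IsImmersionOfComplement.isImmersion (F := ℝ) fun p => ?_
  obtain ⟨i, hi⟩ := exists_mem_affineDomain p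
  obtain ⟨U, hU, hp⟩ := exists_isSmall hm.out p
  have hsource : ((affineChart i).restr U).source = affineDomain i ∩ U := by
    rw [OpenPartialHomeomorph.restr_source, hU.isOpen.interior_eq]
    rfl
  have hi_atlas : affineChart i ∈ atlas (Fin m → ℂ) (ComplexProjectiveSpace m) := ⟨i, rfl⟩
  have hU_atlas : chart i U hU ∈ atlas (EuclideanHalfSpace (2 * m + 1)) (TwistedCylinder m) :=
    ⟨i, U, hU, rfl⟩
  refine Manifold.IsImmersionAtOfComplement.mk_of_charts
    ((ContinuousLinearEquiv.prodComm ℝ (Fin m → ℂ) ℝ).trans (euclideanEquivRealProdComplex m).symm)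
    ((affineChart i).restr U) (chart i U hU) (hsource ▸ ⟨hi, hp⟩)
    (mk_mem_chart_source hU ⟨hp, zero_lt_two⟩ hi)
    (restr_mem_maximalAtlas _ (IsManifold.subset_maximalAtlas hi_atlas) hU.isOpen)
    (IsManifold.subset_maximalAtlas hU_atlas) ?_ ?_
  · rw [hsource]
    exact fun q hq => mk_mem_chart_source hU ⟨hq.2, zero_lt_two⟩ hq.1
  · intro v hv
    have hv' : v ∈ ((affineChart i).restr U).target := by simpa using hv
    have hvU := ((affineChart i).restr U).map_target hv'
    rw [hsource] at hvU
    change (chart i U hU (boundaryInclusion ((affineChart i).symm v))).1 = _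
    rw [chart_boundaryInclusion (p := (affineChart i).symm v) hU hvU.2,
      (affineChart i).right_inv (mem_univ v)]
    rfl

theorem isSmoothEmbedding_boundaryInclusion :
    Manifold.IsSmoothEmbedding 𝓘(ℝ, Fin m → ℂ) (𝓡∂ (2 * m + 1)) ∞
      (boundaryInclusion : ComplexProjectiveSpace m → TwistedCylinder m) :=
  ⟨isImmersion_boundaryInclusion,
    (continuous_boundaryInclusion.isClosedEmbedding boundaryInclusion_injective).isEmbedding⟩

theorem range_boundaryInclusion :
    range (boundaryInclusion : ComplexProjectiveSpace m → TwistedCylinder m) =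
      (𝓡∂ (2 * m + 1)).boundary (TwistedCylinder m) := by
  ext q
  obtain ⟨i, U, hU, he⟩ := exists_chartAt_eq q
  have hq := mem_chart_source (EuclideanHalfSpace (2 * m + 1)) q
  rw [he] at hq
  obtain ⟨x, hx, -, rfl⟩ := exists_of_mem_chart_source hq
  change _ ↔ extChartAt (𝓡∂ (2 * m + 1)) (mk x) (mk x) ∈ frontier (range (𝓡∂ (2 * m + 1)))
  have hchart : extChartAt (𝓡∂ (2 * m + 1)) (mk x) (mk x) =
      (euclideanEquivRealProdComplex m).symm (x.2, affineChart i x.1) := by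
    simp only [extChartAt, he]
    exact congrArg Subtype.val (chart_mk hU hx)
  rw [frontier_range_modelWithCornersEuclideanHalfSpace, hchart]
  change _ ↔ 0 = (x.2 : ℝ)
  constructor
  · rintro ⟨p, hp⟩
    rw [eq_of_mk_eq_boundaryInclusion hx.2 hp.symm]
  · exact fun h => ⟨x.1, congrArg (fun s => mk (x.1, s)) (Subtype.ext h)⟩

/-- In charts, the differential of the boundary inclusion is an isomorphism onto the vectors of height
zero that preserves the orientation of `ℂ ^ m`. -/
theorem exists_mfderiv_boundaryInclusion (p : ComplexProjectiveSpace m) :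
    ∃ L : (Fin m → ℂ) →L[ℝ] (Fin m → ℂ), 0 < L.det ∧ ∀ v : Fin m → ℂ,
      mfderiv 𝓘(ℝ, Fin m → ℂ) (𝓡∂ (2 * m + 1))
        (boundaryInclusion : ComplexProjectiveSpace m → TwistedCylinder m) p v =
      (euclideanEquivRealProdComplex m).symm (0, L v) := by
  obtain ⟨i, hi⟩ : chartAt (Fin m → ℂ) p ∈ range affineChart := chart_mem_atlas _ p
  obtain ⟨i', U, hU, he⟩ := exists_chartAt_eq (boundaryInclusion p)
  have hp := mem_chart_source (Fin m → ℂ) p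
  have hιp := mem_chart_source (EuclideanHalfSpace (2 * m + 1)) (boundaryInclusion p)
  rw [← hi] at hp
  rw [he] at hιp
  obtain ⟨hpU, hpi'⟩ := mem_of_boundaryInclusion_mem_chart_source hιp
  have hpp : (affineChart i).symm (affineChart i p) = p := (affineChart i).left_inv hp
  obtain ⟨L, hL, hdet⟩ := exists_hasFDerivAt_affineChart_transition
    (i := i) (i' := i') (w := affineChart i p) (hpp.symm ▸ hpi')
  refine ⟨L, hdet, fun v => ?_⟩
  set E := euclideanEquivRealProdComplex m
  let D : (Fin m → ℂ) →L[ℝ] EuclideanSpace ℝ (Fin (2 * m + 1)) :=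
    (E.symm : _ →L[ℝ] _) ∘L (0 : (Fin m → ℂ) →L[ℝ] ℝ).prod L
  have hder : HasFDerivAt (fun v => E.symm (0, affineChart i' ((affineChart i).symm v)))
      D (affineChart i p) :=
    E.symm.hasFDerivAt.comp _ ((hasFDerivAt_const (0 : ℝ) _).prodMk hL)
  have hU' : ∀ᶠ v in 𝓝 (affineChart i p), (affineChart i).symm v ∈ U :=
    ((affineChart i).continuousAt_symm (mem_univ _)).preimage_mem_nhds
      (hU.isOpen.mem_nhds (hpp.symm ▸ hpU))
  have hM : HasMFDerivAt 𝓘(ℝ, Fin m → ℂ) (𝓡∂ (2 * m + 1))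
      (boundaryInclusion : ComplexProjectiveSpace m → TwistedCylinder m) p
      D := by
    refine ⟨continuous_boundaryInclusion.continuousAt, HasFDerivAt.hasFDerivWithinAt ?_⟩
    simp only [writtenInExtChartAt, extChartAt, he, ← hi]
    refine hder.congr_of_eventuallyEq ?_
    filter_upwards [hU'] with v hv
    exact chart_boundaryInclusion hU hv
  rw [hM.mfderiv]
  rfl

theorem isOrientedBoundary_boundaryInclusion :
    IsOrientedBoundary (complexOrientation m) (orientation m) boundaryInclusion where
  isSmoothEmbedding := isSmoothEmbedding_boundaryInclusion
  range_eq := range_boundaryInclusion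
  orientation_eq p b hb w hw := by
    obtain ⟨L, hdet, hL⟩ := exists_mfderiv_boundaryInclusion p
    obtain ⟨c, h0, hc, hor⟩ := exists_basis_orientation_eq_neg (m := m) b hb hdet hw
    exact ⟨c, h0, fun j => (hc j).trans (hL (b j)).symm, hor⟩

end TwistedCylinder

end ComplexProjectiveSpace

theorem mainTheorem1 (k : ℕ) (hk : 0 < k) :
    ∃ (W : Type) (_ : TopologicalSpace W)
      (_ : ChartedSpace (EuclideanHalfSpace (2 * (2 * k - 1) + 1)) W)
      (_ : IsManifold (𝓡∂ (2 * (2 * k - 1) + 1)) ∞ W)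
      (_ : T2Space W) (_ : SecondCountableTopology W) (_ : CompactSpace W)
      (oW : ManifoldOrientation (𝓡∂ (2 * (2 * k - 1) + 1)) (2 * (2 * k - 1) + 1) W)
      (ι : ComplexProjectiveSpace (2 * k - 1) → W),
      IsOrientedBoundary (ComplexProjectiveSpace.complexOrientation (2 * k - 1)) oW ι := by
  have : Fact (Odd (2 * k - 1)) := ⟨⟨k - 1, by omega⟩⟩
  exact ⟨ComplexProjectiveSpace.TwistedCylinder (2 * k - 1), inferInstance, inferInstance,
    inferInstance, inferInstance, inferInstance, inferInstance,
    ComplexProjectiveSpace.TwistedCylinder.orientation _,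
    ComplexProjectiveSpace.TwistedCylinder.boundaryInclusion,
    ComplexProjectiveSpace.TwistedCylinder.isOrientedBoundary_boundaryInclusion⟩
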